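/- Let $\mathcal H,\mathcal G,\mathcal K$ be real Hilbert spaces. For a real Hilbert space $\mathcal E$, let $\Gamma_0(\mathcal E)$ be the set of proper lower semicontinuous convex functions $\varphi:\mathcal E\to\,]-\infty,+\infty]$, let $\operatorname{dom}\varphi=\{\varphi<+\infty\}$, let $\varphi^*(u)=\sup_{x}(\langle x,u\rangle-\varphi(x))$ be the Fenchel conjugate and $\partial\varphi(x)=\{u:\ \varphi(x)+\langle y-x,u\rangle\le\varphi(y)\ \forall y\}$ the subdifferential. For $C\subset\mathcal E$, the strong relative interior $\operatorname{sri}C$ is the set of $x\in C$ such that $\bigcup_{t>0}t(C-x)$ equals the closed linear span of $C-x$. A solution of $\min\varphi$ is a point at which $\varphi$ attains its infimum, with finite value. Let $f\in\Gamma_0(\mathcal H)$, $g\in\Gamma_0(\mathcal K)$, and let $T:\mathcal K\to\mathcal G$ and $K:\mathcal G\to\mathcal H$ be non-zero bounded linear operators such that $\operatorname{ran}T^*\cap\operatorname{dom}g^*\neq\varnothing$. Let $S_P$, $S_D$ and $S_{P^*}$ be the sets of solutions of, respectively, $$(P)\ \min_{y\in\mathcal K}\ g(y)+f(KTy),\qquad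 (D)\ \min_{x\in\mathcal H}\ f^*(x)+g^*(-T^*K^*x),\qquad (P^*)\ \min_{u\in\mathcal G}\ (g^*\circ(-T^*))^*(u)+f(-Ku),$$ and consider the problem of finding $$(\hat x,\hat u)\in\mathcal H\times\mathcal G\quad\text{such that}\quad 0\in\partial f^*(\hat x)+K\hat u\quad\text{and}\quad 0\in\partial\big(g^*\circ(-T^*)\big)^*(\hat u)-K^*\hat x.\tag{I}$$ 1. Suppose that $\hat y\in S_P$ and that one of the following holds: (a) $0\in\partial g(\hat y)+T^*K^*\partial f(KT\hat y)$; (b) $0\in\operatorname{sri}(\operatorname{dom}f-KT\operatorname{dom}g)$. Then there exists $\hat x\in S_D$ such that $(\hat x,-T\hat y)$ is a solution of (I). 2. Suppose that $\hat x\in S_D$ and that one of the following holds: (a) $0\in\partial f^*(\hat x)-KT\,\partial g^*(-T^*K^*\hat x)$; (b) $0\in\operatorname{sri}(\operatorname{dom}g^*+T^*K^*\operatorname{dom}f^*)$; (c) $0\in\operatorname{sri}\big(\operatorname{dom}(g^*\circ(-T^*))-K^*\operatorname{dom}f^*\big)$ and $0\in\operatorname{sri}(\operatorname{dom}g^*-\operatorname{ran}T^*)$.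 Then there exists $\hat y\in S_P$ such that $(\hat x,-T\hat y)$ is a solution of (I). 3. If $0\in\operatorname{sri}(\operatorname{dom}g^*-\operatorname{ran}T^*)$ and $(\hat x,\hat u)$ is a solution of (I), then $(\hat x,\hat u)\in S_D\times S_{P^*}$ and there exists $\hat y\in S_P$ such that $\hat u=-T\hat y$. -/

import Mathlib

open scoped Pointwise

namespace SplitADMM

section Basic

variable {E : Type*} [NormedAddCommGroup E] [InnerProductSpace ℝ E]

/-- The effective domain of an extended real-valued function. -/
def dom (f : E → EReal) : Set E := {x | f x < ⊤}

/-- The class of proper lower semicontinuous convex functions `f : E → ]-∞, +∞]`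
(convexity means convexity of the epigraph). -/
structure IsGammaZero (f : E → EReal) : Prop where
  ne_bot : ∀ x, f x ≠ ⊥
  dom_nonempty : (dom f).Nonempty
  lowerSemicontinuous : LowerSemicontinuous f
  convex_epigraph : Convex ℝ {p : E × ℝ | f p.1 ≤ (p.2 : EReal)}

/-- The Fenchel conjugate `f* u = sup_x (⟪x, u⟫ - f x)`. -/
noncomputable def fenchelConj (f : E → EReal) (u : E) : EReal :=
  ⨆ x : E, ((inner ℝ x u : ℝ) : EReal) - f x

/-- The subdifferential `∂f x = {u | ∀ y, f x + ⟪y - x, u⟫ ≤ f y}`. -/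
def subdiff (f : E → EReal) (x : E) : Set E :=
  {u | ∀ y, f x + ((inner ℝ (y - x) u : ℝ) : EReal) ≤ f y}

/-- The strong relative interior: the points `x ∈ C` such that the conical hull
`{t • (c - x) | t > 0, c ∈ C}` of `C - x` is the closed linear span of `C - x`. -/
def sri (C : Set E) : Set E :=
  {x | x ∈ C ∧
    {z : E | ∃ t : ℝ, 0 < t ∧ ∃ c ∈ C, z = t • (c - x)} =
      closure (Submodule.span ℝ ((fun c => c - x) '' C) : Set E)}

/-- The set of solutions of the problem `min φ`: the points at which `φ` attains its
infimum, the minimal value being a real number. -/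
def minimizers (φ : E → EReal) : Set E :=
  {x | (∃ r : ℝ, φ x = (r : EReal)) ∧ ∀ y, φ x ≤ φ y}

end Basic

section Problems

variable {H G K₀ : Type*}
  [NormedAddCommGroup H] [InnerProductSpace ℝ H] [CompleteSpace H]
  [NormedAddCommGroup G] [InnerProductSpace ℝ G] [CompleteSpace G]
  [NormedAddCommGroup K₀] [InnerProductSpace ℝ K₀] [CompleteSpace K₀]

/-- The function `g* ∘ (-T*)` on `G`. -/
noncomputable def conjCompNegAdjoint (g : K₀ → EReal) (T : K₀ →L[ℝ] G) : G → EReal :=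
  fun v => fenchelConj g (-(T.adjoint v))

/-- Solutions of the primal problem `min_y g y + f (K T y)`. -/
def primalSolutions (f : H → EReal) (g : K₀ → EReal) (T : K₀ →L[ℝ] G) (K : G →L[ℝ] H) :
    Set K₀ :=
  minimizers fun y => g y + f (K (T y))

/-- Solutions of the dual problem `min_x f* x + g* (-T* K* x)`. -/
def dualSolutions (f : H → EReal) (g : K₀ → EReal) (T : K₀ →L[ℝ] G) (K : G →L[ℝ] H) :
    Set H :=
  minimizers fun x => fenchelConj f x + fenchelConj g (-(T.adjoint (K.adjoint x)))

/-- Solutions of the dual of the dual, `min_u (g* ∘ -T*)* u + f (-K u)`. -/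
def bidualSolutions (f : H → EReal) (g : K₀ → EReal) (T : K₀ →L[ℝ] G) (K : G →L[ℝ] H) :
    Set G :=
  minimizers fun u => fenchelConj (conjCompNegAdjoint g T) u + f (-(K u))

/-- Solutions `(x, u)` of the system of inclusions
`0 ∈ ∂f* x + K u`, `0 ∈ ∂(g* ∘ -T*)* u - K* x`. -/
def inclusionSolutions (f : H → EReal) (g : K₀ → EReal) (T : K₀ →L[ℝ] G) (K : G →L[ℝ] H) :
    Set (H × G) :=
  {p | (0 : H) ∈ subdiff (fenchelConj f) p.1 + {K p.2} ∧
    (0 : G) ∈ subdiff (fenchelConj (conjCompNegAdjoint g T)) p.2 - {K.adjoint p.1}}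

end Problems

end SplitADMM

/-!
Everything rests on one remark, `optimal_of_no_gap`: if `g y + f (K T y) + f* x + g* (-T* K* x) ≤ 0`
then, by the Fenchel–Young inequality alone, `y` and `x` solve the primal and the dual problem,
`-T y` solves the dual of the dual, and `(x, -T y)` solves the system of inclusions. The three
assertions thus reduce to producing, from one solution, a partner without duality gap.

When a subgradient inclusion is assumed, the partner is read off from it by the Fenchel–Young
equality, together with the Fenchel–Moreau inequality `f ≤ f**` (`IsGammaZero.le_of_biconj_le`)
when one starts from the dual side.

When a strong relative interior condition is assumed, the partner comes from Attouch–Brezis duality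
(`exists_dual_le_of_zero_mem_sri`): if `0 ∈ sri (dom f - L (dom g))` and `μ` is a lower bound of
`g + f ∘ L`, then some `v` satisfies `f* v + g* (-L* v) ≤ -μ`. Such a `v` is a subgradient at `0` of
the perturbation function `z ↦ inf_y g y + f (L y + z)`, and exists because this function is bounded
above on a ball of the closed linear span `V` of `dom f - L (dom g)`. Indeed, the cone generated by
the domain is `V`, hence `V` is a countable union of multiples of sets on which norms and values are
bounded. These sets are linear images of bounded closed convex subsets of a Hilbert space, so they
are closed (`isClosed_image_of_isBounded_of_convex`), and Baire's theorem applies. The Hahn–Banach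
theorem in `V × ℝ` then supplies a nonvertical supporting hyperplane of the epigraph.

Applied to `g*` and a linear functional, the same duality shows that `(g* ∘ -T*)* u`, when finite,
is attained as `g y` with `u = -T y` (`exists_eq_neg_of_zero_mem_sri`). This is the link between
the bidual variable `u` and the primal variable `y`.
-/

namespace SplitADMM

/-! ### Weak compactness in Hilbert spaces -/

section ClosedImage

variable {X Y : Type*} [NormedAddCommGroup X] [InnerProductSpace ℝ X] [CompleteSpace X]

/-- A decreasing sequence of nonempty bounded closed convex sets in a Hilbert space has a common
point: by the parallelogram law the elements of minimal norm form a Cauchy sequence. -/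
theorem nonempty_iInter_of_antitone_of_convex {C : ℕ → Set X} (hanti : Antitone C)
    (hne : ∀ n, (C n).Nonempty) (hclosed : ∀ n, IsClosed (C n)) (hconv : ∀ n, Convex ℝ (C n))
    (hbdd : Bornology.IsBounded (C 0)) : (⋂ n, C n).Nonempty := by
  have hmin : ∀ n, ∃ x ∈ C n, ∀ y ∈ C n, ‖x‖ ≤ ‖y‖ := by
    intro n
    obtain ⟨x, hx, hx'⟩ :=
      exists_norm_eq_iInf_of_complete_convex (hne n) (hclosed n).isComplete (hconv n) 0
    refine ⟨x, hx, fun y hy => ?_⟩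
    have hle : ⨅ w : C n, ‖0 - (w : X)‖ ≤ ‖0 - y‖ :=
      ciInf_le ⟨0, Set.forall_mem_range.2 fun _ => norm_nonneg _⟩ (⟨y, hy⟩ : C n)
    rw [← hx'] at hle
    simpa using hle
  choose x hxC hxmin using hmin
  have hmono : Monotone fun n => ‖x n‖ := fun n m hnm => hxmin n _ (hanti hnm (hxC m))
  have hsq_mono : Monotone fun n => ‖x n‖ ^ 2 := fun n m hnm =>
    pow_le_pow_left₀ (norm_nonneg _) (hmono hnm) 2
  obtain ⟨R, hR⟩ := hbdd.exists_norm_le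
  have hbound : BddAbove (Set.range fun n => ‖x n‖ ^ 2) :=
    ⟨R ^ 2, Set.forall_mem_range.2 fun n =>
      pow_le_pow_left₀ (norm_nonneg _) (hR _ (hanti (Nat.zero_le n) (hxC n))) 2⟩
  have hcauchy_sq : CauchySeq fun n => ‖x n‖ ^ 2 :=
    (tendsto_atTop_ciSup hsq_mono hbound).cauchySeq
  have hdist : ∀ n m, n ≤ m → ‖x m - x n‖ ^ 2 ≤ 2 * (‖x m‖ ^ 2 - ‖x n‖ ^ 2) := by
    intro n m hnm
    have hmid : (1 / 2 : ℝ) • x m + (1 / 2 : ℝ) • x n ∈ C n :=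
      hconv n (hanti hnm (hxC m)) (hxC n) (by norm_num) (by norm_num) (by norm_num)
    have hle := hxmin n _ hmid
    rw [← smul_add, norm_smul, Real.norm_of_nonneg (by norm_num)] at hle
    have hpar := parallelogram_law_with_norm ℝ (x m) (x n)
    nlinarith [norm_nonneg (x n), norm_nonneg (x m + x n)]
  have hcauchy : CauchySeq x := by
    rw [Metric.cauchySeq_iff']
    intro ε hε
    obtain ⟨N, hN⟩ := Metric.cauchySeq_iff'.1 hcauchy_sq (ε ^ 2 / 2) (by positivity)
    refine ⟨N, fun n hn => ?_⟩
    have h1 := hN n hn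
    rw [Real.dist_eq] at h1
    have h2 := (le_abs_self _).trans_lt h1
    have h3 := hdist N n hn
    rw [dist_eq_norm]
    exact lt_of_pow_lt_pow_left₀ 2 hε.le (by linarith)
  obtain ⟨z, hz⟩ := cauchySeq_tendsto_of_complete hcauchy
  refine ⟨z, Set.mem_iInter.2 fun n => (hclosed n).mem_of_tendsto hz ?_⟩
  filter_upwards [Filter.eventually_ge_atTop n] with m hm using hanti hm (hxC m)

/-- The continuous linear image of a bounded closed convex subset of a Hilbert space is closed;
this is the only form of weak compactness that is needed. -/
theorem isClosed_image_of_isBounded_of_convex [NormedAddCommGroup Y] [NormedSpace ℝ Y]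
    (A : X →L[ℝ] Y) {C : Set X} (hC : IsClosed C) (hconv : Convex ℝ C)
    (hbdd : Bornology.IsBounded C) : IsClosed (A '' C) := by
  refine isClosed_of_closure_subset fun z hz => ?_
  obtain ⟨x, hx⟩ := nonempty_iInter_of_antitone_of_convex
    (C := fun n : ℕ => C ∩ A ⁻¹' Metric.closedBall z (1 / ((n : ℝ) + 1)))
    (fun n m hnm => Set.inter_subset_inter_right _ <| Set.preimage_mono <|
      Metric.closedBall_subset_closedBall <| one_div_le_one_div_of_le (by positivity) (by gcongr))
    (fun n => by
      obtain ⟨_, ⟨x, hxC, rfl⟩, hx⟩ := Metric.mem_closure_iff.1 hz (1 / ((n : ℝ) + 1))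
        (by positivity)
      exact ⟨x, hxC, by simpa [dist_comm] using hx.le⟩)
    (fun n => hC.inter (Metric.isClosed_closedBall.preimage A.continuous))
    (fun n => hconv.inter ((convex_closedBall _ _).linear_preimage A.toLinearMap))
    (hbdd.subset Set.inter_subset_left)
  rw [Set.mem_iInter] at hx
  refine ⟨x, (hx 0).1, ?_⟩
  refine dist_le_zero.1 (ge_of_tendsto' tendsto_one_div_add_atTop_nhds_zero_nat fun n => ?_)
  exact (hx n).2

end ClosedImage

/-! ### Conjugates, subgradients and minimizers through real bounds -/

section ExtendedReal

variable {E : Type*}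

theorem exists_coe_eq_of_mem_dom {f : E → EReal} (hbot : ∀ x, f x ≠ ⊥) {x : E} (hx : x ∈ dom f) :
    ∃ r : ℝ, f x = r :=
  ⟨(f x).toReal, (EReal.coe_toReal hx.ne (hbot x)).symm⟩

theorem mem_minimizers_of_le {φ : E → EReal} {x : E} {p q : ℝ} (hx : φ x ≤ p)
    (h : ∀ z, (q : EReal) ≤ φ z) (hpq : p ≤ q) : x ∈ minimizers φ :=
  ⟨⟨q, le_antisymm (hx.trans (EReal.coe_le_coe_iff.2 hpq)) (h x)⟩,
    fun z => (hx.trans (EReal.coe_le_coe_iff.2 hpq)).trans (h z)⟩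

theorem exists_coe_eq_of_add_eq_coe {a b : EReal} (ha : a ≠ ⊥) (hb : b ≠ ⊥) {r : ℝ}
    (h : a + b = r) : ∃ p q : ℝ, a = p ∧ b = q ∧ p + q = r := by
  induction a with
  | bot => exact absurd rfl ha
  | top => rw [EReal.top_add_of_ne_bot hb] at h; exact absurd h.symm (EReal.coe_ne_top r)
  | coe p =>
    induction b with
    | bot => exact absurd rfl hb
    | top => rw [EReal.coe_add_top] at h; exact absurd h.symm (EReal.coe_ne_top r)
    | coe q => exact ⟨p, q, rfl, rfl, by exact_mod_cast h⟩

end ExtendedReal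

section Conjugate

variable {E F : Type*} [NormedAddCommGroup E] [InnerProductSpace ℝ E]
  [NormedAddCommGroup F] [InnerProductSpace ℝ F]

/-- An upper bound `c` on `f* u` is the same as the affine minorant `⟪·, u⟫ - c` of `f`. -/
theorem fenchelConj_le_coe_iff {f : E → EReal} {u : E} {c : ℝ} :
    fenchelConj f u ≤ c ↔ ∀ x, ((inner ℝ x u - c : ℝ) : EReal) ≤ f x := by
  rw [fenchelConj, iSup_le_iff]
  refine forall_congr' fun x => ?_
  induction f x with
  | bot => simp [-EReal.coe_sub]
  | top => simp
  | coe r =>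
    rw [← EReal.coe_sub, EReal.coe_le_coe_iff, EReal.coe_le_coe_iff]
    exact ⟨fun h => by linarith, fun h => by linarith⟩

theorem coe_le_fenchelConj {f : E → EReal} {x : E} {a : ℝ} (h : f x ≤ a) (u : E) :
    ((inner ℝ x u - a : ℝ) : EReal) ≤ fenchelConj f u := by
  refine le_trans ?_ (le_iSup (fun x => ((inner ℝ x u : ℝ) : EReal) - f x) x)
  rw [EReal.coe_sub]
  exact EReal.sub_le_sub le_rfl h

theorem fenchelConj_ne_bot {f : E → EReal} {x : E} {a : ℝ} (h : f x ≤ a) (u : E) :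
    fenchelConj f u ≠ ⊥ := fun hb => by
  have h' := coe_le_fenchelConj h u
  rw [hb] at h'
  exact absurd (le_bot_iff.1 h') (EReal.coe_ne_bot _)

/-- If `⟪·, s⟫ - e` is an affine minorant of `φ` that dominates an upper bound of `φ` at `x`, then
`s` is a subgradient of `φ` at `x`. -/
theorem mem_subdiff_of_le {φ : E → EReal} {x s : E} {c e : ℝ} (hx : φ x ≤ c)
    (hs : ∀ z, ((inner ℝ z s - e : ℝ) : EReal) ≤ φ z) (h : c + e ≤ inner ℝ x s) :
    s ∈ subdiff φ x := by
  intro z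
  refine (add_le_add hx le_rfl).trans (le_trans ?_ (hs z))
  rw [← EReal.coe_add, EReal.coe_le_coe_iff, inner_sub_left]
  linarith

/-- The Fenchel–Young equality at a subgradient. -/
theorem exists_of_mem_subdiff {φ : E → EReal} (hbot : ∀ x, φ x ≠ ⊥) (hdom : (dom φ).Nonempty)
    {x s : E} (hs : s ∈ subdiff φ x) :
    ∃ a : ℝ, φ x = a ∧ fenchelConj φ s ≤ ((inner ℝ x s - a : ℝ) : EReal) := by
  obtain ⟨z, hz⟩ := hdom
  have hx : x ∈ dom φ := by
    refine (lt_top_iff_ne_top (a := φ x)).2 fun htop => ?_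
    have h := hs z
    rw [htop, EReal.top_add_coe] at h
    exact hz.not_ge h
  obtain ⟨a, ha⟩ := exists_coe_eq_of_mem_dom hbot hx
  refine ⟨a, ha, fenchelConj_le_coe_iff.2 fun z => le_trans (le_of_eq ?_) (hs z)⟩
  rw [ha, ← EReal.coe_add, inner_sub_left]
  congr 1
  ring

/-- A nonvertical separating hyperplane yields a point of the domain of the conjugate. -/
theorem fenchelConj_smul_inv_le {f : E → EReal} (hbot : ∀ x, f x ≠ ⊥) {w : E} {β c : ℝ}
    (hβ : 0 < β)
    (h : ∀ (y : E) (s : ℝ), f y ≤ s → inner ℝ y w - β * s ≤ c) :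
    fenchelConj f (β⁻¹ • w) ≤ ((β⁻¹ * c : ℝ) : EReal) := by
  refine fenchelConj_le_coe_iff.2 fun y => ?_
  by_cases hy : f y = ⊤
  · rw [hy]; exact le_top
  obtain ⟨s, hs⟩ := exists_coe_eq_of_mem_dom hbot (lt_top_iff_ne_top.2 hy)
  have h' := h y s hs.le
  rw [hs, EReal.coe_le_coe_iff, real_inner_smul_right, ← mul_sub, inv_mul_le_iff₀ hβ]
  linarith

/-! ### Stability of the class of proper lower semicontinuous convex functions -/

theorem IsGammaZero.le_convex_combination {f : E → EReal} (hf : IsGammaZero f) {x y : E}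
    {a b s t : ℝ} (hx : f x ≤ a) (hy : f y ≤ b) (hs : 0 ≤ s) (ht : 0 ≤ t) (hst : s + t = 1) :
    f (s • x + t • y) ≤ ((s * a + t * b : ℝ) : EReal) :=
  hf.convex_epigraph (x := (x, a)) hx (y := (y, b)) hy hs ht hst

theorem IsGammaZero.isClosed_epigraph {f : E → EReal} (hf : IsGammaZero f) :
    IsClosed {p : E × ℝ | f p.1 ≤ (p.2 : EReal)} :=
  hf.lowerSemicontinuous.isClosed_epigraph.preimage
    (continuous_fst.prodMk (continuous_coe_real_ereal.comp continuous_snd))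

theorem IsGammaZero.exists_le {f : E → EReal} (hf : IsGammaZero f) : ∃ (x : E) (a : ℝ), f x ≤ a :=
  let ⟨x, hx⟩ := hf.dom_nonempty
  let ⟨a, ha⟩ := exists_coe_eq_of_mem_dom hf.ne_bot hx
  ⟨x, a, ha.le⟩

theorem IsGammaZero.comp_clm {f : E → EReal} (hf : IsGammaZero f) (A : F →L[ℝ] E)
    (hdom : ∃ v, f (A v) < ⊤) : IsGammaZero fun v => f (A v) where
  ne_bot _ := hf.ne_bot _
  dom_nonempty := hdom
  lowerSemicontinuous := hf.lowerSemicontinuous.comp A.continuous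
  convex_epigraph :=
    hf.convex_epigraph.linear_preimage (A.toLinearMap.prodMap (LinearMap.id : ℝ →ₗ[ℝ] ℝ))

theorem isGammaZero_inner (u : E) : IsGammaZero fun v : E => ((inner ℝ v u : ℝ) : EReal) where
  ne_bot _ := EReal.coe_ne_bot _
  dom_nonempty := ⟨0, EReal.coe_lt_top _⟩
  lowerSemicontinuous :=
    (continuous_coe_real_ereal.comp (continuous_id.inner continuous_const)).lowerSemicontinuous
  convex_epigraph := by
    rintro ⟨x, a⟩ hx ⟨y, b⟩ hy s t hs ht -
    simp only [Set.mem_ofPred_eq, EReal.coe_le_coe_iff] at hx hy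
    simp only [Set.mem_ofPred_eq, EReal.coe_le_coe_iff, Prod.smul_mk, Prod.mk_add_mk, inner_add_left,
      real_inner_smul_left, smul_eq_mul]
    gcongr

end Conjugate

/-! ### The Fenchel–Moreau theorem -/

section Moreau

variable {E : Type*} [NormedAddCommGroup E] [InnerProductSpace ℝ E] [CompleteSpace E]

/-- Strict separation of a point below the graph from the epigraph. The separating hyperplane is
possibly vertical (`β = 0`), but not when the point lies over the domain. -/
theorem IsGammaZero.exists_separation {f : E → EReal} (hf : IsGammaZero f) {x : E} {r : ℝ}
    (hr : (r : EReal) < f x) :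
    ∃ (w : E) (β c : ℝ), 0 ≤ β ∧ c < inner ℝ x w - β * r ∧
      ∀ (y : E) (s : ℝ), f y ≤ s → inner ℝ y w - β * s ≤ c := by
  obtain ⟨ℓ, c, hlt, hgt⟩ := geometric_hahn_banach_closed_point hf.convex_epigraph
    hf.isClosed_epigraph (x := (x, r)) (fun h => (not_le.2 hr) h)
  have hℓ : ∀ (y : E) (s : ℝ),
      ℓ (y, s) = inner ℝ y ((InnerProductSpace.toDual ℝ E).symm
        (ℓ.comp (ContinuousLinearMap.inl ℝ E ℝ))) - (-ℓ (0, 1)) * s := by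
    intro y s
    rw [real_inner_comm, InnerProductSpace.toDual_symm_apply]
    have h : ((y, s) : E × ℝ) = (y, 0) + s • (0, 1) := by simp
    rw [h, map_add, map_smul]
    simp only [ContinuousLinearMap.comp_apply, ContinuousLinearMap.inl_apply, smul_eq_mul]
    ring
  refine ⟨_, -ℓ (0, 1), c, ?_, by rw [← hℓ]; exact hgt, fun y s hs => by
    rw [← hℓ]; exact (hlt (y, s) hs).le⟩
  -- the epigraph is unbounded upwards, so the functional cannot increase in that direction
  by_contra! hneg
  obtain ⟨y, a, ha⟩ := hf.exists_le
  have hup : ∀ t : ℝ, 0 ≤ t → ℓ (y, a) + t * ℓ (0, 1) < c := by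
    intro t ht
    have h := hlt (y, a + t) (ha.trans (EReal.coe_le_coe_iff.2 (by linarith)))
    rw [hℓ] at h ⊢
    linarith
  have hpos : 0 < ℓ (0, 1) := by linarith
  have h0 := hup 0 le_rfl
  have h1 := hup ((c - ℓ (y, a)) / ℓ (0, 1)) (div_nonneg (by linarith) hpos.le)
  rw [div_mul_cancel₀ _ hpos.ne'] at h1
  linarith

theorem IsGammaZero.exists_fenchelConj_le {f : E → EReal} (hf : IsGammaZero f) :
    ∃ (u : E) (c : ℝ), fenchelConj f u ≤ c := by
  obtain ⟨x, hx⟩ := hf.dom_nonempty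
  obtain ⟨a, ha⟩ := exists_coe_eq_of_mem_dom hf.ne_bot hx
  obtain ⟨w, β, c, hβ, hlt, h⟩ := hf.exists_separation (x := x) (r := a - 1)
    (by rw [ha, EReal.coe_lt_coe_iff]; linarith)
  have hβ' : 0 < β := by
    have := h x a ha.le
    nlinarith
  exact ⟨_, _, fenchelConj_smul_inv_le hf.ne_bot hβ' h⟩

theorem IsGammaZero.fenchelConj {f : E → EReal} (hf : IsGammaZero f) :
    IsGammaZero (fenchelConj f) where
  ne_bot u := let ⟨_, _, ha⟩ := hf.exists_le; fenchelConj_ne_bot ha u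
  dom_nonempty := let ⟨u, c, hc⟩ := hf.exists_fenchelConj_le; ⟨u, hc.trans_lt (EReal.coe_lt_top c)⟩
  lowerSemicontinuous := by
    refine lowerSemicontinuous_iSup fun x => ?_
    rcases eq_or_ne (f x) ⊤ with hx | hx
    · simp only [hx, EReal.sub_top]
      exact lowerSemicontinuous_const
    · obtain ⟨a, ha⟩ := exists_coe_eq_of_mem_dom hf.ne_bot (lt_top_iff_ne_top.2 hx)
      simp only [ha, ← EReal.coe_sub]
      exact (continuous_coe_real_ereal.comp
        ((continuous_const.inner continuous_id).sub continuous_const)).lowerSemicontinuous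
  convex_epigraph := by
    rintro ⟨u, a⟩ hu ⟨v, b⟩ hv s t hs ht hst
    rw [Set.mem_ofPred_eq, fenchelConj_le_coe_iff] at hu hv
    change SplitADMM.fenchelConj f (s • u + t • v) ≤ ((s • a + t • b : ℝ) : EReal)
    refine fenchelConj_le_coe_iff.2 fun x => ?_
    by_cases hx : f x = ⊤
    · rw [hx]; exact le_top
    obtain ⟨r, hr⟩ := exists_coe_eq_of_mem_dom hf.ne_bot (lt_top_iff_ne_top.2 hx)
    have h1 := hu x
    have h2 := hv x
    rw [hr, EReal.coe_le_coe_iff] at h1 h2 ⊢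
    have h3 := mul_le_mul_of_nonneg_left h1 hs
    have h4 := mul_le_mul_of_nonneg_left h2 ht
    have h5 : s * r + t * r = r := by rw [← add_mul, hst, one_mul]
    simp only [inner_add_right, real_inner_smul_right, smul_eq_mul]
    linarith

/-- The nontrivial inequality `f ≤ f**` of the **Fenchel–Moreau theorem**. -/
theorem IsGammaZero.le_of_biconj_le {f : E → EReal} (hf : IsGammaZero f) {x : E} {r : ℝ}
    (h : SplitADMM.fenchelConj (SplitADMM.fenchelConj f) x ≤ r) : f x ≤ r := by
  by_contra! hlt
  obtain ⟨w, β, c, hβ, hsep, hepi⟩ := hf.exists_separation hlt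
  have hval : ∀ (u : E) (d : ℝ), SplitADMM.fenchelConj f u ≤ d → inner ℝ x u - d ≤ r := by
    intro u d hd
    have h' := (coe_le_fenchelConj hd x).trans h
    rwa [EReal.coe_le_coe_iff, real_inner_comm] at h'
  rcases hβ.eq_or_lt with rfl | hβ
  · -- a vertical hyperplane is tilted by adding large multiples of it to an affine minorant
    obtain ⟨u₀, d₀, h₀⟩ := hf.exists_fenchelConj_le
    have hpos : 0 < inner ℝ x w - c := by linarith
    have htilt : ∀ t : ℝ, 0 ≤ t → (inner ℝ x u₀ - d₀) + t * (inner ℝ x w - c) ≤ r := by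
      intro t ht
      have hconj : SplitADMM.fenchelConj f (u₀ + t • w) ≤ ((d₀ + t * c : ℝ) : EReal) := by
        refine fenchelConj_le_coe_iff.2 fun y => ?_
        by_cases hy : f y = ⊤
        · rw [hy]; exact le_top
        obtain ⟨s, hs⟩ := exists_coe_eq_of_mem_dom hf.ne_bot (lt_top_iff_ne_top.2 hy)
        have h1 := fenchelConj_le_coe_iff.1 h₀ y
        have h2 := mul_le_mul_of_nonneg_left (hepi y s hs.le) ht
        rw [hs, EReal.coe_le_coe_iff] at h1 ⊢
        rw [inner_add_right, real_inner_smul_right]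
        linarith
      have := hval _ _ hconj
      rw [inner_add_right, real_inner_smul_right] at this
      linarith
    have h1 := htilt ((|r - (inner ℝ x u₀ - d₀)| + 1) / (inner ℝ x w - c))
      (div_nonneg (by positivity) hpos.le)
    rw [div_mul_cancel₀ _ hpos.ne'] at h1
    linarith [le_abs_self (r - (inner ℝ x u₀ - d₀))]
  · have := hval _ _ (fenchelConj_smul_inv_le hf.ne_bot hβ hepi)
    rw [real_inner_smul_right, ← mul_sub, inv_mul_le_iff₀ hβ] at this
    linarith

end Moreau

/-! ### Strong duality under the Attouch–Brezis condition -/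

section AttouchBrezis

variable {X Y : Type*} [NormedAddCommGroup X] [InnerProductSpace ℝ X]
  [NormedAddCommGroup Y] [InnerProductSpace ℝ Y]

/-- The differences `w - L y` with `y` and `w` of norm, and of value under `g` and `f`, at most `m`.
These sets exhaust `dom f - L (dom g)` as `m` grows. -/
def boundedDifference (f : Y → EReal) (g : X → EReal) (L : X →L[ℝ] Y) (m : ℝ) : Set Y :=
  {z | ∃ y w, ‖y‖ ≤ m ∧ ‖w‖ ≤ m ∧ g y ≤ (m : EReal) ∧ f w ≤ (m : EReal) ∧ w - L y = z}

/-- The strict epigraph of the perturbation function `z ↦ inf_y g y + f (L y + z)`. -/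
def perturbationEpigraph (f : Y → EReal) (g : X → EReal) (L : X →L[ℝ] Y) : Set (Y × ℝ) :=
  {p | ∃ (y : X) (w : Y) (a b : ℝ),
    g y ≤ (a : EReal) ∧ f w ≤ (b : EReal) ∧ w - L y = p.1 ∧ a + b < p.2}

theorem convex_perturbationEpigraph {f : Y → EReal} (hf : IsGammaZero f) {g : X → EReal}
    (hg : IsGammaZero g) (L : X →L[ℝ] Y) : Convex ℝ (perturbationEpigraph f g L) := by
  rintro ⟨z, r⟩ ⟨y, w, a, b, hy, hw, rfl, hr⟩ ⟨z', r'⟩ ⟨y', w', a', b', hy', hw', rfl, hr'⟩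
    s t hs ht hst
  refine ⟨_, _, _, _, hg.le_convex_combination hy hy' hs ht hst,
    hf.le_convex_combination hw hw' hs ht hst, ?_, ?_⟩
  · simp only [map_add, map_smul, Prod.smul_mk, Prod.mk_add_mk, smul_sub]
    abel
  · simp only [Prod.smul_mk, Prod.mk_add_mk, smul_eq_mul] at hr hr' ⊢
    rcases hs.eq_or_lt with rfl | hs
    · have : t = 1 := by linarith
      subst this
      linarith
    · have h1 := mul_lt_mul_of_pos_left hr hs
      have h2 := mul_le_mul_of_nonneg_left hr'.le ht
      linarith

theorem convex_dom {f : Y → EReal} (hf : IsGammaZero f) : Convex ℝ (dom f) := by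
  intro x hx y hy s t hs ht hst
  obtain ⟨a, ha⟩ := exists_coe_eq_of_mem_dom hf.ne_bot hx
  obtain ⟨b, hb⟩ := exists_coe_eq_of_mem_dom hf.ne_bot hy
  exact (hf.le_convex_combination ha.le hb.le hs ht hst).trans_lt (EReal.coe_lt_top _)

theorem IsGammaZero.convex_sublevel {f : Y → EReal} (hf : IsGammaZero f) (m : ℝ) :
    Convex ℝ {y | f y ≤ (m : EReal)} := by
  intro x hx y hy s t hs ht hst
  have h := hf.le_convex_combination hx hy hs ht hst
  rwa [← add_mul, hst, one_mul] at h

theorem exists_mem_boundedDifference {f : Y → EReal} (hf : IsGammaZero f) {g : X → EReal}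
    (hg : IsGammaZero g) (L : X →L[ℝ] Y) {z : Y} (hz : z ∈ dom f - L '' dom g) :
    ∃ m : ℕ, z ∈ boundedDifference f g L m := by
  obtain ⟨w, hw, _, ⟨y, hy, rfl⟩, rfl⟩ := hz
  obtain ⟨a, ha⟩ := exists_coe_eq_of_mem_dom hg.ne_bot hy
  obtain ⟨b, hb⟩ := exists_coe_eq_of_mem_dom hf.ne_bot hw
  obtain ⟨m, hm⟩ := exists_nat_ge (max (max ‖y‖ ‖w‖) (max a b))
  simp only [max_le_iff] at hm
  exact ⟨m, y, w, hm.1.1, hm.1.2, ha.le.trans (EReal.coe_le_coe_iff.2 hm.2.1),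
    hb.le.trans (EReal.coe_le_coe_iff.2 hm.2.2), rfl⟩

variable [CompleteSpace X] [CompleteSpace Y]

theorem isClosed_boundedDifference {f : Y → EReal} (hf : IsGammaZero f) {g : X → EReal}
    (hg : IsGammaZero g) (L : X →L[ℝ] Y) (m : ℝ) : IsClosed (boundedDifference f g L m) := by
  let e := WithLp.prodContinuousLinearEquiv 2 ℝ X Y
  let p : WithLp 2 (X × Y) →L[ℝ] X := (ContinuousLinearMap.fst ℝ X Y).comp e.toContinuousLinearMap
  let q : WithLp 2 (X × Y) →L[ℝ] Y := (ContinuousLinearMap.snd ℝ X Y).comp e.toContinuousLinearMap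
  let C : Set (WithLp 2 (X × Y)) :=
    p ⁻¹' (Metric.closedBall 0 m ∩ {y | g y ≤ (m : EReal)}) ∩
      q ⁻¹' (Metric.closedBall 0 m ∩ {w | f w ≤ (m : EReal)})
  have himage : boundedDifference f g L m = (q - L.comp p) '' C := by
    ext z
    constructor
    · rintro ⟨y, w, hy, hw, hgy, hfw, rfl⟩
      exact ⟨e.symm (y, w), ⟨⟨by simpa [p, e] using hy, by simpa [p, e] using hgy⟩,
        ⟨by simpa [q, e] using hw, by simpa [q, e] using hfw⟩⟩, by simp [p, q, e]⟩
    · rintro ⟨v, ⟨⟨hy, hgy⟩, ⟨hw, hfw⟩⟩, rfl⟩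
      exact ⟨p v, q v, by simpa using hy, by simpa using hw, hgy, hfw, rfl⟩
  rw [himage]
  refine isClosed_image_of_isBounded_of_convex _ ?_ ?_ ?_
  · exact ((Metric.isClosed_closedBall.inter
      (hg.lowerSemicontinuous.isClosed_preimage _)).preimage p.continuous).inter
      ((Metric.isClosed_closedBall.inter
        (hf.lowerSemicontinuous.isClosed_preimage _)).preimage q.continuous)
  · exact (((convex_closedBall _ _).inter (hg.convex_sublevel m)).linear_preimage p.toLinearMap).inter
      (((convex_closedBall _ _).inter (hf.convex_sublevel m)).linear_preimage q.toLinearMap)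
  · refine (((Metric.isBounded_closedBall (x := (0 : X)) (r := m)).prod
      (Metric.isBounded_closedBall (x := (0 : Y)) (r := m))).image
        e.symm.toContinuousLinearMap).subset ?_
    intro v hv
    exact ⟨e v, ⟨hv.1.1, hv.2.1⟩, e.symm_apply_apply v⟩

/-- Under the Attouch–Brezis condition, Baire's theorem makes one of the sets `boundedDifference`
contain a ball of the closed span of `dom f - L (dom g)`. -/
theorem exists_ball_subset_boundedDifference {f : Y → EReal} (hf : IsGammaZero f) {g : X → EReal}
    (hg : IsGammaZero g) (L : X →L[ℝ] Y) {V : Submodule ℝ Y} [CompleteSpace V]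
    (h0 : (0 : Y) ∈ dom f - L '' dom g)
    (hcone : ∀ z ∈ V, ∃ t : ℝ, 0 < t ∧ ∃ c ∈ dom f - L '' dom g, z = t • c) :
    ∃ (m : ℝ) (z₀ : V) (r : ℝ), 0 < r ∧
      ∀ z : V, z ∈ Metric.ball z₀ r → (z : Y) ∈ boundedDifference f g L m := by
  let S : ℕ × ℕ → Set V := fun k =>
    (fun z : V => ((k.1 + 1 : ℝ)⁻¹ • (z : Y))) ⁻¹' boundedDifference f g L k.2
  have hclosed : ∀ k, IsClosed (S k) := fun k =>
    (isClosed_boundedDifference hf hg L _).preimage (continuous_subtype_val.const_smul _)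
  have hcover : ⋃ k, S k = Set.univ := by
    refine Set.eq_univ_of_forall fun z => ?_
    obtain ⟨t, ht, c, hc, hz⟩ := hcone z z.2
    obtain ⟨n, hn⟩ := exists_nat_ge t
    have hmem : ((n + 1 : ℝ)⁻¹ * t) • c ∈ dom f - L '' dom g := by
      refine (((convex_dom hf).sub ((convex_dom hg).linear_image L.toLinearMap)).starConvex
        h0).smul_mem hc (by positivity) ?_
      rw [inv_mul_le_iff₀ (by positivity)]
      linarith
    obtain ⟨m, hm⟩ := exists_mem_boundedDifference hf hg L hmem
    refine Set.mem_iUnion.2 ⟨(n, m), ?_⟩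
    change (n + 1 : ℝ)⁻¹ • (z : Y) ∈ boundedDifference f g L m
    rwa [hz, smul_smul]
  obtain ⟨⟨n, m⟩, z₁, hz₁⟩ := nonempty_interior_of_iUnion_of_closed hclosed hcover
  obtain ⟨r, hr, hball⟩ := Metric.isOpen_iff.1 isOpen_interior z₁ hz₁
  have hn : (0 : ℝ) < n + 1 := by positivity
  refine ⟨m, (n + 1 : ℝ)⁻¹ • z₁, (n + 1 : ℝ)⁻¹ * r, by positivity, fun z hz => ?_⟩
  have hz' : (n + 1 : ℝ) • z ∈ Metric.ball z₁ r := by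
    rw [Metric.mem_ball, dist_eq_norm] at hz ⊢
    have heq : (n + 1 : ℝ) • z - z₁ = (n + 1 : ℝ) • (z - (n + 1 : ℝ)⁻¹ • z₁) := by
      rw [smul_sub, smul_inv_smul₀ hn.ne']
    rw [heq, norm_smul, Real.norm_of_nonneg hn.le]
    rwa [lt_inv_mul_iff₀ hn] at hz
  have h := interior_subset (hball hz')
  change (n + 1 : ℝ)⁻¹ • ((n + 1 : ℝ) • (z : Y)) ∈ boundedDifference f g L m at h
  rwa [inv_smul_smul₀ hn.ne'] at h

/-- The perturbation function is subdifferentiable at `0` under the Attouch–Brezis condition: the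
subgradient is the slope of a hyperplane supporting its epigraph in the closed span of its domain. -/
theorem exists_perturbation_subgradient {f : Y → EReal} (hf : IsGammaZero f) {g : X → EReal}
    (hg : IsGammaZero g) (L : X →L[ℝ] Y) (hsri : (0 : Y) ∈ sri (dom f - L '' dom g)) {μ : ℝ}
    (hμ : ∀ (y : X) (a b : ℝ), g y ≤ a → f (L y) ≤ b → μ ≤ a + b) :
    ∃ v : Y, ∀ (y : X) (w : Y) (a b : ℝ), g y ≤ a → f w ≤ b →
      μ + inner ℝ (w - L y) v ≤ a + b := by
  obtain ⟨h0, hcone⟩ := hsri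
  set D := dom f - L '' dom g with hD
  simp only [sub_zero, Set.image_id'] at hcone
  let V : Submodule ℝ Y := (Submodule.span ℝ D).topologicalClosure
  have hVclosed : IsClosed (V : Set Y) := Submodule.isClosed_topologicalClosure _
  have : CompleteSpace V := hVclosed.completeSpace_coe
  have hVcone : ∀ z ∈ V, ∃ t : ℝ, 0 < t ∧ ∃ c ∈ D, z = t • c := by
    intro z hz
    have hz' : z ∈ closure (Submodule.span ℝ D : Set Y) := hz
    rwa [← hcone] at hz'
  have hDV : ∀ z ∈ D, z ∈ V := fun z hz => subset_closure (Submodule.subset_span hz)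
  obtain ⟨m, z₀, r, hr, hball⟩ := exists_ball_subset_boundedDifference hf hg L h0 hVcone
  let S : Set (V × ℝ) := {p | ((p.1 : Y), p.2) ∈ perturbationEpigraph f g L}
  have hSconv : Convex ℝ S := (convex_perturbationEpigraph hf hg L).linear_preimage
    (V.subtype.prodMap (LinearMap.id : ℝ →ₗ[ℝ] ℝ))
  have hSint : (interior S).Nonempty := by
    refine ⟨(z₀, 2 * m + 1), mem_interior.2
      ⟨Metric.ball z₀ r ×ˢ Set.Ioi (2 * m), ?_, Metric.isOpen_ball.prod isOpen_Ioi,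
        Metric.mem_ball_self hr, by simp⟩⟩
    rintro ⟨z, s⟩ ⟨hz, hs⟩
    obtain ⟨y, w, -, -, hy, hw, hyw⟩ := hball z hz
    exact ⟨y, w, m, m, hy, hw, hyw, by rw [Set.mem_Ioi] at hs; simpa [two_mul] using hs⟩
  have hnotin : ((0 : V), μ) ∉ interior S := fun h => by
    obtain ⟨y, w, a, b, hy, hw, hyw, hab⟩ := interior_subset h
    simp only [Submodule.coe_zero, sub_eq_zero] at hyw hab
    rw [hyw] at hw
    linarith [hμ y a b hy hw]
  obtain ⟨ℓ, hℓ0, hℓ⟩ := geometric_hahn_banach_of_nonempty_interior_point hSconv hnotin hSint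
  let u : V := (InnerProductSpace.toDual ℝ V).symm (ℓ.comp (ContinuousLinearMap.inl ℝ V ℝ))
  have hsplit : ∀ (z : V) (s : ℝ), ℓ (z, s) = inner ℝ (z : Y) (u : Y) - (-ℓ (0, 1)) * s := by
    intro z s
    have hu : inner ℝ (z : Y) (u : Y) = ℓ (z, 0) := by
      rw [← Submodule.coe_inner, real_inner_comm, InnerProductSpace.toDual_symm_apply]
      rfl
    have h : ((z, s) : V × ℝ) = (z, 0) + s • (0, 1) := by simp
    rw [hu, h, map_add, map_smul, smul_eq_mul]
    ring
  set β : ℝ := -ℓ (0, 1) with hβ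
  have hsupport : ∀ (y : X) (w : Y) (a b s : ℝ), g y ≤ a → f w ≤ b → a + b < s →
      inner ℝ (w - L y) (u : Y) - β * s ≤ -(β * μ) := by
    intro y w a b s hy hw hs
    have hz : w - L y ∈ V := hDV _ ⟨w, hw.trans_lt (EReal.coe_lt_top b), L y,
      ⟨y, hy.trans_lt (EReal.coe_lt_top a), rfl⟩, rfl⟩
    have h := hℓ (⟨w - L y, hz⟩, s) ⟨y, w, a, b, hy, hw, rfl, hs⟩
    rw [hsplit, hsplit] at h
    simpa using h
  have hlim : ∀ (y : X) (w : Y) (a b : ℝ), g y ≤ a → f w ≤ b →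
      inner ℝ (w - L y) (u : Y) - β * (a + b) ≤ -(β * μ) := by
    intro y w a b hy hw
    have hcont : Filter.Tendsto (fun s : ℝ => inner ℝ (w - L y) (u : Y) - β * s)
        (nhdsWithin (a + b) (Set.Ioi (a + b))) (nhds (inner ℝ (w - L y) (u : Y) - β * (a + b))) :=
      (Continuous.tendsto (by fun_prop) _).mono_left nhdsWithin_le_nhds
    exact le_of_tendsto hcont
      (by filter_upwards [self_mem_nhdsWithin] with s hs using hsupport y w a b s hy hw hs)
  -- the hyperplane is not vertical: otherwise `u` would be nonpositive on the cone spanned by `D`,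
  -- which is all of `V`
  have hβpos : 0 < β := by
    obtain ⟨w, hw, _, ⟨y, hy, rfl⟩, hyw⟩ := h0
    obtain ⟨a, ha⟩ := exists_coe_eq_of_mem_dom hg.ne_bot hy
    obtain ⟨b, hb⟩ := exists_coe_eq_of_mem_dom hf.ne_bot hw
    have hβnonneg : 0 ≤ β := by
      by_contra! hneg
      have h := hsupport y w a b (|a + b| + |μ| + 1) ha.le hb.le
        (by linarith [le_abs_self (a + b), abs_nonneg μ])
      have hyw' : w - L y = 0 := hyw
      rw [hyw', inner_zero_left] at h
      nlinarith [le_abs_self μ, abs_nonneg (a + b)]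
    refine hβnonneg.lt_of_ne fun hzero => hℓ0 ?_
    have hu : u = 0 := by
      obtain ⟨t, ht, c, ⟨w', hw', _, ⟨y', hy', rfl⟩, hc⟩, hut⟩ := hVcone u u.2
      obtain ⟨a', ha'⟩ := exists_coe_eq_of_mem_dom hg.ne_bot hy'
      obtain ⟨b', hb'⟩ := exists_coe_eq_of_mem_dom hf.ne_bot hw'
      have h := hlim y' w' a' b' ha'.le hb'.le
      have hc' : w' - L y' = c := hc
      rw [hc', ← hzero] at h
      have hself : inner ℝ (u : Y) (u : Y) = t * inner ℝ c (u : Y) := by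
        conv_lhs => enter [2]; rw [hut]
        rw [real_inner_smul_left]
      have hle : inner ℝ (u : Y) (u : Y) ≤ 0 := by
        rw [hself]
        exact mul_nonpos_of_nonneg_of_nonpos ht.le (by linarith)
      exact Subtype.ext (inner_self_eq_zero.1 (hle.antisymm real_inner_self_nonneg))
    ext z <;> simp [hsplit, hu, ← hzero]
  refine ⟨β⁻¹ • (u : Y), fun y w a b hy hw => ?_⟩
  have h := hlim y w a b hy hw
  rw [real_inner_smul_right, ← le_sub_iff_add_le', inv_mul_le_iff₀ hβpos]
  linarith

/-- **Attouch–Brezis duality**: under the strong relative interior condition, any finite lower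
bound `μ` of `g + f ∘ L` is matched by some `v` in the Fenchel–Rockafellar dual. -/
theorem exists_dual_le_of_zero_mem_sri {f : Y → EReal} (hf : IsGammaZero f) {g : X → EReal}
    (hg : IsGammaZero g) (L : X →L[ℝ] Y) (hsri : (0 : Y) ∈ sri (dom f - L '' dom g)) {μ : ℝ}
    (hμ : ∀ (y : X) (a b : ℝ), g y ≤ a → f (L y) ≤ b → μ ≤ a + b) :
    ∃ (v : Y) (c d : ℝ), fenchelConj f v ≤ c ∧ fenchelConj g (-(L.adjoint v)) ≤ d ∧
      μ + c + d ≤ 0 := by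
  obtain ⟨v, hv⟩ := exists_perturbation_subgradient hf hg L hsri hμ
  have hbound : ∀ (y : X) (a : ℝ), g y ≤ a →
      fenchelConj f v ≤ ((a - μ + inner ℝ (L y) v : ℝ) : EReal) := by
    intro y a hy
    refine fenchelConj_le_coe_iff.2 fun w => ?_
    by_cases hw : f w = ⊤
    · rw [hw]; exact le_top
    obtain ⟨b, hb⟩ := exists_coe_eq_of_mem_dom hf.ne_bot (lt_top_iff_ne_top.2 hw)
    have h := hv y w a b hy hb.le
    rw [inner_sub_left] at h
    rw [hb, EReal.coe_le_coe_iff]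
    linarith
  obtain ⟨y₀, a₀, h₀⟩ := hg.exists_le
  obtain ⟨c, hc⟩ := exists_coe_eq_of_mem_dom hf.fenchelConj.ne_bot
    ((hbound y₀ a₀ h₀).trans_lt (EReal.coe_lt_top _))
  refine ⟨v, c, -μ - c, hc.le, fenchelConj_le_coe_iff.2 fun y => ?_, by linarith⟩
  by_cases hy : g y = ⊤
  · rw [hy]; exact le_top
  obtain ⟨a, ha⟩ := exists_coe_eq_of_mem_dom hg.ne_bot (lt_top_iff_ne_top.2 hy)
  have h := hbound y a ha.le
  rw [hc, EReal.coe_le_coe_iff] at h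
  rw [ha, EReal.coe_le_coe_iff, inner_neg_right, ContinuousLinearMap.adjoint_inner_right]
  linarith

end AttouchBrezis

/-! ### Optimality certificates -/

section Certificates

variable {H G K₀ : Type*}
  [NormedAddCommGroup H] [InnerProductSpace ℝ H] [CompleteSpace H]
  [NormedAddCommGroup G] [InnerProductSpace ℝ G] [CompleteSpace G]
  [NormedAddCommGroup K₀] [InnerProductSpace ℝ K₀] [CompleteSpace K₀]

theorem fenchelConj_conjCompNegAdjoint_le {g : K₀ → EReal} {T : K₀ →L[ℝ] G} {y : K₀} {a : ℝ}
    (h : g y ≤ a) : fenchelConj (conjCompNegAdjoint g T) (-(T y)) ≤ a := by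
  refine fenchelConj_le_coe_iff.2 fun v => ?_
  have h' := coe_le_fenchelConj h (-(T.adjoint v))
  rwa [inner_neg_right, ContinuousLinearMap.adjoint_inner_right, real_inner_comm,
    ← inner_neg_right] at h'

theorem isGammaZero_conjCompNegAdjoint {g : K₀ → EReal} (hg : IsGammaZero g) {T : K₀ →L[ℝ] G}
    (hdom : (Set.range T.adjoint ∩ dom (fenchelConj g)).Nonempty) :
    IsGammaZero (conjCompNegAdjoint g T) := by
  refine hg.fenchelConj.comp_clm (-T.adjoint) ?_
  obtain ⟨_, ⟨v, rfl⟩, hv⟩ := hdom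
  exact ⟨-v, by simpa [dom] using hv⟩

/-- A primal-dual pair without duality gap is optimal for all three problems and solves the system
of inclusions. -/
theorem optimal_of_no_gap {f : H → EReal} {g : K₀ → EReal} {T : K₀ →L[ℝ] G} {K : G →L[ℝ] H}
    {y : K₀} {x : H} {a b c d : ℝ} (ha : g y ≤ a) (hb : f (K (T y)) ≤ b) (hc : fenchelConj f x ≤ c)
    (hd : fenchelConj g (-(T.adjoint (K.adjoint x))) ≤ d) (hgap : a + b + c + d ≤ 0) :
    y ∈ primalSolutions f g T K ∧ x ∈ dualSolutions f g T K ∧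
      -(T y) ∈ bidualSolutions f g T K ∧ (x, -(T y)) ∈ inclusionSolutions f g T K := by
  have hc' := fenchelConj_le_coe_iff.1 hc
  have hd' := fenchelConj_le_coe_iff.1 hd
  have hTK : ∀ (z : K₀) (v : H),
      inner ℝ z (T.adjoint (K.adjoint v)) = inner ℝ (K (T z)) v := fun z v => by
    rw [ContinuousLinearMap.adjoint_inner_right, ContinuousLinearMap.adjoint_inner_right]
  have hh := fenchelConj_conjCompNegAdjoint_le (T := T) ha
  have hKx : conjCompNegAdjoint g T (K.adjoint x) ≤ (d : EReal) := hd
  have hfy : inner ℝ (K (T y)) x - c ≤ b := EReal.coe_le_coe_iff.1 ((hc' _).trans hb)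
  have hgy : inner ℝ y (-(T.adjoint (K.adjoint x))) - d ≤ a :=
    EReal.coe_le_coe_iff.1 ((hd' y).trans ha)
  rw [inner_neg_right, hTK] at hgy
  refine ⟨?_, ?_, ?_, ?_, ?_⟩
  · refine mem_minimizers_of_le (p := a + b) (q := -(c + d)) ?_ (fun z => ?_) (by linarith)
    · rw [EReal.coe_add]; exact add_le_add ha hb
    · refine le_trans ?_ (add_le_add (hd' z) (hc' (K (T z))))
      rw [← EReal.coe_add, EReal.coe_le_coe_iff, inner_neg_right, hTK]
      linarith
  · refine mem_minimizers_of_le (p := c + d) (q := -(a + b)) ?_ (fun z => ?_) (by linarith)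
    · rw [EReal.coe_add]; exact add_le_add hc hd
    · refine le_trans ?_ (add_le_add (coe_le_fenchelConj hb z)
        (coe_le_fenchelConj ha (-(T.adjoint (K.adjoint z)))))
      rw [← EReal.coe_add, EReal.coe_le_coe_iff, inner_neg_right, hTK]
      linarith
  · refine mem_minimizers_of_le (p := a + b) (q := -(c + d)) ?_ (fun u => ?_) (by linarith)
    · rw [EReal.coe_add]
      refine add_le_add hh ?_
      rwa [map_neg, neg_neg]
    · refine le_trans ?_ (add_le_add (coe_le_fenchelConj hKx u) (hc' (-(K u))))
      rw [← EReal.coe_add, EReal.coe_le_coe_iff, inner_neg_left,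
        ContinuousLinearMap.adjoint_inner_left, real_inner_comm (K u)]
      linarith
  · refine Set.mem_add.2 ⟨K (T y), ?_, K (-(T y)), rfl, by simp⟩
    refine mem_subdiff_of_le hc (fun z => ?_) (e := b) (by rw [real_inner_comm]; linarith)
    rw [real_inner_comm]
    exact coe_le_fenchelConj hb z
  · refine Set.mem_sub.2 ⟨K.adjoint x, ?_, K.adjoint x, rfl, sub_self _⟩
    refine mem_subdiff_of_le hh (fun u => ?_) (e := d) ?_
    · rw [real_inner_comm]
      exact coe_le_fenchelConj hKx u
    · rw [inner_neg_left, ContinuousLinearMap.adjoint_inner_right]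
      linarith

/-- Under the qualification condition on `g*` and `ran T*`, the conjugate of `g* ∘ (-T*)` is the
infimal postcomposition of `g` by `-T`, and the infimum is attained. -/
theorem exists_eq_neg_of_zero_mem_sri {g : K₀ → EReal} (hg : IsGammaZero g) {T : K₀ →L[ℝ] G}
    (hsri : (0 : K₀) ∈ sri (dom (fenchelConj g) - Set.range T.adjoint)) {u : G} {p : ℝ}
    (hu : fenchelConj (conjCompNegAdjoint g T) u ≤ p) : ∃ y, g y ≤ p ∧ u = -(T y) := by
  have hdom : dom (fun v : G => ((inner ℝ v (-u) : ℝ) : EReal)) = Set.univ :=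
    Set.eq_univ_of_forall fun v => EReal.coe_lt_top _
  have hrange : (-T.adjoint : G →L[ℝ] K₀) '' dom (fun v : G => ((inner ℝ v (-u) : ℝ) : EReal)) =
      Set.range T.adjoint := by
    rw [hdom, Set.image_univ, ← (neg_surjective (G := G)).range_comp]
    congr 1
    ext v
    simp
  obtain ⟨y, c, d, hc, hd, hcd⟩ := exists_dual_le_of_zero_mem_sri hg.fenchelConj
    (isGammaZero_inner (-u)) (-T.adjoint) (by rwa [hrange]) (μ := -p) (fun v a b ha hb => by
      have h := (fenchelConj_le_coe_iff.1 hu v).trans hb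
      rw [EReal.coe_le_coe_iff] at h ha
      rw [inner_neg_right] at ha
      linarith)
  have hlin : ∀ v : G, inner ℝ v (T y + u) ≤ d := by
    intro v
    have h := fenchelConj_le_coe_iff.1 hd v
    rw [EReal.coe_le_coe_iff] at h
    simp only [map_neg, ContinuousLinearMap.adjoint_adjoint, neg_apply, neg_neg,
      inner_neg_right] at h
    rw [inner_add_right]
    linarith
  have hd0 : 0 ≤ d := by simpa using hlin 0
  -- a linear functional bounded above vanishes
  have hzero : T y + u = 0 := by
    by_contra hne
    have hpos : 0 < inner ℝ (T y + u) (T y + u) := real_inner_self_pos.2 hne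
    have h := hlin (((d + 1) / inner ℝ (T y + u) (T y + u)) • (T y + u))
    rw [real_inner_smul_left, div_mul_cancel₀ _ hpos.ne'] at h
    linarith
  exact ⟨y, (hg.le_of_biconj_le hc).trans (EReal.coe_le_coe_iff.2 (by linarith)),
    eq_neg_of_add_eq_zero_right hzero⟩

/-! ### The three implications -/

theorem exists_dual_of_primal {f : H → EReal} (hf : IsGammaZero f) {g : K₀ → EReal}
    (hg : IsGammaZero g) {T : K₀ →L[ℝ] G} {K : G →L[ℝ] H} {y : K₀}
    (hy : y ∈ primalSolutions f g T K)
    (hq : (0 : K₀) ∈ subdiff g y +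
          (fun v => T.adjoint (K.adjoint v)) '' subdiff f (K (T y)) ∨
        (0 : H) ∈ sri (dom f - (fun z => K (T z)) '' dom g)) :
    ∃ x ∈ dualSolutions f g T K, (x, -(T y)) ∈ inclusionSolutions f g T K := by
  rcases hq with hq | hq
  · obtain ⟨s, hs, _, ⟨x, hx, rfl⟩, hsx⟩ := Set.mem_add.1 hq
    obtain rfl := eq_neg_of_add_eq_zero_left hsx
    obtain ⟨a, ha, ha'⟩ := exists_of_mem_subdiff hg.ne_bot hg.dom_nonempty hs
    obtain ⟨b, hb, hb'⟩ := exists_of_mem_subdiff hf.ne_bot hf.dom_nonempty hx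
    have h := optimal_of_no_gap ha.le hb.le hb' ha' (by
      rw [inner_neg_right, ContinuousLinearMap.adjoint_inner_right,
        ContinuousLinearMap.adjoint_inner_right]
      linarith)
    exact ⟨x, h.2.1, h.2.2.2⟩
  · obtain ⟨⟨r, hr⟩, hmin⟩ := hy
    obtain ⟨a, b, ha, hb, rfl⟩ := exists_coe_eq_of_add_eq_coe (hg.ne_bot _) (hf.ne_bot _) hr
    obtain ⟨x, c, d, hc, hd, hcd⟩ := exists_dual_le_of_zero_mem_sri hf hg (K.comp T) hq
      (μ := a + b) (fun z a' b' ha' hb' => by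
        have h := hmin z
        simp only [hr] at h
        have h' := h.trans (add_le_add ha' hb')
        exact_mod_cast h')
    rw [ContinuousLinearMap.adjoint_comp] at hd
    have h := optimal_of_no_gap ha.le hb.le hc hd hcd
    exact ⟨x, h.2.1, h.2.2.2⟩

theorem exists_primal_of_dual {f : H → EReal} (hf : IsGammaZero f) {g : K₀ → EReal}
    (hg : IsGammaZero g) {T : K₀ →L[ℝ] G} {K : G →L[ℝ] H}
    (hdom : (Set.range T.adjoint ∩ dom (fenchelConj g)).Nonempty) {x : H}
    (hx : x ∈ dualSolutions f g T K)
    (hq : (0 : H) ∈ subdiff (fenchelConj f) x -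
          (fun z => K (T z)) '' subdiff (fenchelConj g) (-(T.adjoint (K.adjoint x))) ∨
        (0 : K₀) ∈ sri (dom (fenchelConj g) +
          (fun v => T.adjoint (K.adjoint v)) '' dom (fenchelConj f)) ∨
        ((0 : G) ∈ sri (dom (conjCompNegAdjoint g T) - K.adjoint '' dom (fenchelConj f)) ∧
          (0 : K₀) ∈ sri (dom (fenchelConj g) - Set.range T.adjoint))) :
    ∃ y ∈ primalSolutions f g T K, (x, -(T y)) ∈ inclusionSolutions f g T K := by
  obtain ⟨⟨r, hr⟩, hmin⟩ := hx
  obtain ⟨c, d, hc, hd, rfl⟩ := exists_coe_eq_of_add_eq_coe (hf.fenchelConj.ne_bot _)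
    (hg.fenchelConj.ne_bot _) hr
  have hlower : ∀ (z : H) (a b : ℝ), fenchelConj f z ≤ a →
      fenchelConj g (-(T.adjoint (K.adjoint z))) ≤ b → c + d ≤ a + b := by
    intro z a b ha hb
    have h := hmin z
    simp only [hr] at h
    exact_mod_cast h.trans (add_le_add ha hb)
  suffices h : ∃ (y : K₀) (a b : ℝ), g y ≤ a ∧ f (K (T y)) ≤ b ∧ a + b + c + d ≤ 0 by
    obtain ⟨y, a, b, ha, hb, hab⟩ := h
    have h := optimal_of_no_gap ha hb hc.le hd.le hab
    exact ⟨y, h.1, h.2.2.2⟩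
  rcases hq with hq | hq | ⟨hq, hq'⟩
  · obtain ⟨s, hs, _, ⟨y, hy, rfl⟩, hsy⟩ := Set.mem_sub.1 hq
    obtain rfl := sub_eq_zero.1 hsy
    obtain ⟨c', hc', hb⟩ := exists_of_mem_subdiff hf.fenchelConj.ne_bot
      hf.fenchelConj.dom_nonempty hs
    obtain ⟨d', hd', ha⟩ := exists_of_mem_subdiff hg.fenchelConj.ne_bot
      hg.fenchelConj.dom_nonempty hy
    refine ⟨y, _, _, hg.le_of_biconj_le ha, hf.le_of_biconj_le hb, ?_⟩
    rw [hc, EReal.coe_eq_coe_iff] at hc'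
    rw [hd, EReal.coe_eq_coe_iff] at hd'
    rw [inner_neg_left, ContinuousLinearMap.adjoint_inner_left,
      ContinuousLinearMap.adjoint_inner_left]
    linarith
  · have hset : dom (fenchelConj g) - (-(K.comp T).adjoint : H →L[ℝ] K₀) '' dom (fenchelConj f) =
        dom (fenchelConj g) + (fun v => T.adjoint (K.adjoint v)) '' dom (fenchelConj f) := by
      rw [sub_eq_add_neg, ← Set.image_neg_eq_neg, Set.image_image]
      simp [ContinuousLinearMap.adjoint_comp]
    obtain ⟨y, a, b, ha, hb, hab⟩ := exists_dual_le_of_zero_mem_sri hg.fenchelConj hf.fenchelConj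
      (-(K.comp T).adjoint) (by rwa [hset]) (μ := c + d) (fun z a b ha hb => hlower z a b ha (by
        simpa [ContinuousLinearMap.adjoint_comp] using hb))
    refine ⟨y, a, b, hg.le_of_biconj_le ha, hf.le_of_biconj_le ?_, by linarith⟩
    simpa using hb
  · obtain ⟨u, p, b, hp, hb, hab⟩ := exists_dual_le_of_zero_mem_sri
      (isGammaZero_conjCompNegAdjoint hg hdom) hf.fenchelConj K.adjoint hq (μ := c + d) hlower
    obtain ⟨y, ha, rfl⟩ := exists_eq_neg_of_zero_mem_sri hg hq' hp
    refine ⟨y, p, b, ha, hf.le_of_biconj_le ?_, by linarith⟩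
    simpa using hb

theorem exists_primal_of_inclusion {f : H → EReal} (hf : IsGammaZero f) {g : K₀ → EReal}
    (hg : IsGammaZero g) {T : K₀ →L[ℝ] G} {K : G →L[ℝ] H}
    (hdom : (Set.range T.adjoint ∩ dom (fenchelConj g)).Nonempty)
    (hq : (0 : K₀) ∈ sri (dom (fenchelConj g) - Set.range T.adjoint)) {x : H} {u : G}
    (hxu : (x, u) ∈ inclusionSolutions f g T K) :
    (x, u) ∈ dualSolutions f g T K ×ˢ bidualSolutions f g T K ∧
      ∃ y ∈ primalSolutions f g T K, u = -(T y) := by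
  obtain ⟨h1, h2⟩ := hxu
  obtain ⟨s, hs, _, rfl, hsu⟩ := Set.mem_add.1 h1
  obtain rfl := eq_neg_of_add_eq_zero_left hsu
  obtain ⟨v, hv, _, rfl, hvx⟩ := Set.mem_sub.1 h2
  obtain rfl := sub_eq_zero.1 hvx
  have hh := isGammaZero_conjCompNegAdjoint hg hdom
  obtain ⟨c, hc, hb⟩ := exists_of_mem_subdiff hf.fenchelConj.ne_bot
    hf.fenchelConj.dom_nonempty hs
  obtain ⟨p, hp, hd⟩ := exists_of_mem_subdiff hh.fenchelConj.ne_bot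
    hh.fenchelConj.dom_nonempty hv
  obtain ⟨y, ha, rfl⟩ := exists_eq_neg_of_zero_mem_sri hg hq hp.le
  have hb' := hf.le_of_biconj_le hb
  simp only [map_neg, neg_neg] at hb'
  have h := optimal_of_no_gap ha hb' hc.le (hh.le_of_biconj_le hd) (by
    rw [inner_neg_left, ContinuousLinearMap.adjoint_inner_right, real_inner_comm]
    linarith)
  exact ⟨⟨h.2.1, h.2.2.1⟩, y, h.1, rfl⟩

end Certificates

end SplitADMM

open SplitADMM in
theorem mainTheorem6 {H G K₀ : Type*}
    [NormedAddCommGroup H] [InnerProductSpace ℝ H] [CompleteSpace H]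
    [NormedAddCommGroup G] [InnerProductSpace ℝ G] [CompleteSpace G]
    [NormedAddCommGroup K₀] [InnerProductSpace ℝ K₀] [CompleteSpace K₀]
    (f : H → EReal) (hf : IsGammaZero f)
    (g : K₀ → EReal) (hg : IsGammaZero g)
    (T : K₀ →L[ℝ] G) (hT : T ≠ 0) (K : G →L[ℝ] H) (hK : K ≠ 0)
    (hdom : (Set.range T.adjoint ∩ dom (fenchelConj g)).Nonempty) :
    (∀ y ∈ primalSolutions f g T K,
      ((0 : K₀) ∈ subdiff g y +
          (fun v => T.adjoint (K.adjoint v)) '' subdiff f (K (T y)) ∨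
        (0 : H) ∈ sri (dom f - (fun z => K (T z)) '' dom g)) →
      ∃ x ∈ dualSolutions f g T K, (x, -(T y)) ∈ inclusionSolutions f g T K) ∧
    (∀ x ∈ dualSolutions f g T K,
      ((0 : H) ∈ subdiff (fenchelConj f) x -
          (fun z => K (T z)) '' subdiff (fenchelConj g) (-(T.adjoint (K.adjoint x))) ∨
        (0 : K₀) ∈ sri (dom (fenchelConj g) +
          (fun v => T.adjoint (K.adjoint v)) '' dom (fenchelConj f)) ∨
        ((0 : G) ∈ sri (dom (conjCompNegAdjoint g T) - K.adjoint '' dom (fenchelConj f)) ∧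
          (0 : K₀) ∈ sri (dom (fenchelConj g) - Set.range T.adjoint))) →
      ∃ y ∈ primalSolutions f g T K, (x, -(T y)) ∈ inclusionSolutions f g T K) ∧
    ((0 : K₀) ∈ sri (dom (fenchelConj g) - Set.range T.adjoint) →
      ∀ x : H, ∀ u : G, (x, u) ∈ inclusionSolutions f g T K →
        (x, u) ∈ dualSolutions f g T K ×ˢ bidualSolutions f g T K ∧
        ∃ y ∈ primalSolutions f g T K, u = -(T y)) :=
  ⟨fun _ hy hq => exists_dual_of_primal hf hg hy hq,
    fun _ hx hq => exists_primal_of_dual hf hg hdom hx hq,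
    fun hq _ _ hxu => exists_primal_of_inclusion hf hg hdom hq hxu⟩
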